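/- Let $n>1$ and let $\mathcal L=\{1,\dots,n\}$ be a set of locations. An economy consists of a driver supply $m>0$ and, for every trip $(i,j)\in\mathcal L^2$ (including $i=j$), a duration $d_{ij}>0$, a cost $c_{ij}\ge 0$ and a demand function $q_{ij}:[0,\infty)\to[0,\infty)$ that is continuously differentiable with $q_{ij}'(r)<0$ for all $r\ge 0$ (one-sided derivative at $0$) and $\int_0^\infty q_{ij}(r)\,dr<\infty$. Let $v_{ij}:(0,q_{ij}(0)]\to[0,\infty)$ be the inverse function of $q_{ij}$, extended by $v_{ij}(s)=\infty$ for $s\le 0$ and $v_{ij}(s)=-\infty$ for $s>q_{ij}(0)$; thus $\int_0^{x}v_{ij}(s)\,ds=-\infty$ unless $0\le x\le q_{ij}(0)$. A pair $(x,y)$ with a rider flow $x=(x_{ij})$ and a driver flow $y=(y_{ij})$ is a feasible flow if $x_{ij}\ge 0$, $y_{ij}\ge 0$ and $x_{ij}\le y_{ij}$ for all $i,j$, $\sum_{i,j}d_{ij}y_{ij}\le m$, and $\sum_j y_{ij}=\sum_j y_{ji}$ for all $i$. It is welfare-optimal if it maximizes $$\sum_{i,j\in\mathcal L}\Bigl(\int_0^{x_{ij}}v_{ij}(s)\,ds-c_{ij}y_{ij}\Bigr)$$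 over all $x,y\in\mathbb R^{n\times n}$ with $x_{ij}\le y_{ij}$ for all $i,j$, $\sum_{i,j}d_{ij}y_{ij}\le m$, and $\sum_j y_{ij}=\sum_j y_{ji}$ for all $i$. Let $\mathcal C$ be the set of directed cycles $((i_1,i_2),(i_2,i_3),\dots,(i_\ell,i_1))$ with $\ell\ge 1$ and $i_1,\dots,i_\ell\in\mathcal L$ pairwise distinct, up to rotation. For prices $p=(p_{ij})$ and $\kappa\in\mathcal C$, put $\mu_\kappa=\sum_{(i,j)\in\kappa}(p_{ij}-c_{ij})\big/\sum_{(i,j)\in\kappa}d_{ij}$. A triple $(x,y,p)$ is a competitive equilibrium (CE) if $(x,y)$ is a feasible flow, $p_{ij}\ge 0$ for all $i,j$, and 1. $x_{ij}=q_{ij}(p_{ij})$ for all $i,j$; 2. for all $i,j$, if $y_{ij}>x_{ij}$ then $p_{ij}=0$; 3. if $\max_{\kappa\in\mathcal C}\mu_\kappa>0$ then $\sum_{i,j}d_{ij}y_{ij}=m$; 4. if $\max_{\kappa\in\mathcal C}\mu_\kappa<0$ then $y_{ij}=0$ for all $i,j$; 5. there are weights $w_\kappa\ge 0$ $(\kappa\in\mathcal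 C)$ with $\sum_{\kappa\ni(i,j)}w_\kappa=y_{ij}$ for all $i,j$ such that $\mu_\kappa=\max_{\kappa'\in\mathcal C}\mu_{\kappa'}$ for every $\kappa$ with $w_\kappa>0$. **Welfare Theorem.** A feasible flow $(x,y)$ is welfare-optimal if and only if there exist prices $p$ such that $(x,y,p)$ is a CE. Moreover, for every CE $(x,y,p)$ there exist $\omega\ge 0$ and $\phi\in\mathbb R^n$ such that $$p_{ij}=c_{ij}+d_{ij}\,\omega+\phi_i-\phi_j\qquad\text{for all } i,j\in\mathcal L.$$ -/

import Mathlib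

noncomputable section

namespace Ridesharing

open scoped Classical in
/-- A set of trips on the locations `Fin n` is a directed cycle if it consists of the trips
`(v 0, v 1), (v 1, v 2), …, (v ℓ, v 0)` for pairwise distinct locations `v 0, …, v ℓ`
(the addition `k + 1` in `Fin (ℓ + 1)` wraps around). The trip `(i, i)` alone is a cycle
(`ℓ = 0`). Sequences of trips that differ by a rotation have the same set of trips and are the
same cycle; conversely the set of trips determines the cyclic sequence. -/
def IsDirectedCycle {n : ℕ} (κ : Finset (Fin n × Fin n)) : Prop :=
  ∃ (ℓ : ℕ) (v : Fin (ℓ + 1) → Fin n), Function.Injective v ∧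
    κ = Finset.univ.image (fun k => (v k, v (k + 1)))

/-- The set of all directed cycles on `n` locations. -/
abbrev DirectedCycle (n : ℕ) : Type := {κ : Finset (Fin n × Fin n) // IsDirectedCycle κ}

instance (n : ℕ) : Fintype (DirectedCycle n) := Fintype.ofFinite _

/-- An economy with locations `Fin n`: driver supply `m`, trip durations `d`, trip costs `c`, and
demand functions `q`. The domain of a demand function is `[0, ∞)`: its values at negative numbers
are irrelevant, and `derivWithin` is the derivative of the function on `[0, ∞)`, one-sided at `0`.
-/
structure Economy (n : ℕ) where
  /-- total driver supply -/
  m : ℝ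
  /-- trip durations -/
  d : Fin n → Fin n → ℝ
  /-- trip costs -/
  c : Fin n → Fin n → ℝ
  /-- `q i j r` riders per unit of time want to go from `i` to `j` and are willing to pay `r` -/
  q : Fin n → Fin n → ℝ → ℝ
  m_pos : 0 < m
  d_pos : ∀ i j, 0 < d i j
  c_nonneg : ∀ i j, 0 ≤ c i j
  q_nonneg : ∀ i j, ∀ r, 0 ≤ r → 0 ≤ q i j r
  q_contDiff : ∀ i j, ContDiffOn ℝ 1 (q i j) (Set.Ici 0)
  q_deriv_neg : ∀ i j, ∀ r, 0 ≤ r → derivWithin (q i j) (Set.Ici 0) r < 0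
  q_integrable : ∀ i j, MeasureTheory.IntegrableOn (q i j) (Set.Ici 0)

/-- The value `v(s)` of the `s`-th rider: the inverse of the demand function `q` on `[0, ∞)`,
meaningful for `s` in `(0, q 0]`. -/
def riderValue (q : ℝ → ℝ) (s : ℝ) : ℝ := Function.invFunOn q (Set.Ici 0) s

/-- The total rider value `∫₀ˣ v(s) ds`, where `v` is the inverse of `q` on `(0, q 0]`, extended by
`v(s) = ∞` for `s ≤ 0` and `v(s) = -∞` for `s > q 0`; so the integral is `-∞` unless
`0 ≤ x ≤ q 0`. (For `0 ≤ x ≤ q 0`, the function `v` is integrable on `(0, x]` because `q` is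
integrable on `[0, ∞)`.) -/
def totalRiderValue (q : ℝ → ℝ) (x : ℝ) : EReal :=
  open scoped Classical in
  if 0 ≤ x ∧ x ≤ q 0 then ((∫ s in (0 : ℝ)..x, riderValue q s : ℝ) : EReal) else ⊥

namespace Economy

variable {n : ℕ} (E : Economy n)

/-- Social welfare of the rider flow `x` and the driver flow `y`: total rider value minus driver
cost, per unit of time. -/
def welfare (x y : Fin n → Fin n → ℝ) : EReal :=
  ∑ i, ∑ j, (totalRiderValue (E.q i j) (x i j) - ((E.c i j * y i j : ℝ) : EReal))

/-- The constraints of the welfare maximization program. -/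
structure SatisfiesConstraints (x y : Fin n → Fin n → ℝ) : Prop where
  le : ∀ i j, x i j ≤ y i j
  supply : ∑ i, ∑ j, E.d i j * y i j ≤ E.m
  balance : ∀ i, ∑ j, y i j = ∑ j, y j i

/-- Feasible stationary rider and driver flows. -/
structure IsFeasibleFlow (x y : Fin n → Fin n → ℝ) : Prop
    extends E.SatisfiesConstraints x y where
  rider_nonneg : ∀ i j, 0 ≤ x i j
  driver_nonneg : ∀ i j, 0 ≤ y i j

/-- `(x, y)` is an optimal solution of the welfare maximization program. -/
def IsWelfareOptimal (x y : Fin n → Fin n → ℝ) : Prop :=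
  E.SatisfiesConstraints x y ∧
    ∀ x' y', E.SatisfiesConstraints x' y' → E.welfare x' y' ≤ E.welfare x y

/-- The surplus rate `μ_κ` of the cycle `κ` at trip prices `p`. -/
def surplusRate (p : Fin n → Fin n → ℝ) (κ : DirectedCycle n) : ℝ :=
  (∑ t ∈ κ.1, (p t.1 t.2 - E.c t.1 t.2)) / ∑ t ∈ κ.1, E.d t.1 t.2

/-- The maximal surplus rate over all cycles; there are finitely many cycles and, if there is a
location, at least one, so that the supremum is a maximum. -/
def maxSurplusRate (p : Fin n → Fin n → ℝ) : ℝ := ⨆ κ : DirectedCycle n, E.surplusRate p κ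

theorem isGreatest_maxSurplusRate (hn : 0 < n) (p : Fin n → Fin n → ℝ) :
    IsGreatest (Set.range (E.surplusRate p)) (E.maxSurplusRate p) := by
  have : Nonempty (DirectedCycle n) :=
    ⟨⟨_, 0, fun _ => ⟨0, hn⟩, fun a b _ => Subsingleton.elim (α := Fin 1) a b, rfl⟩⟩
  refine ⟨exists_eq_ciSup_of_finite, ?_⟩
  rintro _ ⟨κ, rfl⟩
  exact le_ciSup (Set.finite_range _).bddAbove κ

open scoped Classical in
/-- `w` is a cycle decomposition of the driver flow `y`. -/
def IsCycleDecomposition (y : Fin n → Fin n → ℝ) (w : DirectedCycle n → ℝ) : Prop :=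
  (∀ κ, 0 ≤ w κ) ∧ ∀ i j, ∑ κ, (if (i, j) ∈ κ.1 then w κ else 0) = y i j

/-- The outcome `(x, y, p)` is feasible and stationary, and is a competitive equilibrium. -/
structure IsCompetitiveEquilibrium (x y p : Fin n → Fin n → ℝ) : Prop where
  feasible : E.IsFeasibleFlow x y
  price_nonneg : ∀ i j, 0 ≤ p i j
  rider_best_response : ∀ i j, x i j = E.q i j (p i j)
  relocation : ∀ i j, x i j < y i j → p i j = 0
  exhaust_supply : 0 < E.maxSurplusRate p → ∑ i, ∑ j, E.d i j * y i j = E.m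
  do_nothing : E.maxSurplusRate p < 0 → ∀ i j, y i j = 0
  cycle_max : ∃ w : DirectedCycle n → ℝ, IsCycleDecomposition y w ∧
    ∀ κ, 0 < w κ → E.surplusRate p κ = E.maxSurplusRate p

end Economy

end Ridesharing

end

/-!
Demand is positive at every price, so in an equilibrium, and in an optimum, every trip has positive
rider and driver flow. This makes linear programming duality elementary: apart from the supply
constraint, `y` can be perturbed in every direction of the linear space of circulations.

From an equilibrium, let `ω` be the maximal surplus rate and `a = p - c - ω d`. The weight `a` is
nonpositive on cycles, hence, by the decomposition of nonnegative circulations into cycles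
(`IsCirculation.exists_isCycleDecomposition`), on all nonnegative circulations, and it vanishes on
`y`. Since `y` is positive everywhere, `a` vanishes on all circulations
(`IsCompetitiveEquilibrium.pairing_eq_zero`). The circulation made of `(i, j)`, `(j, o)` and the
reverse of `(i, o)` yields the potential `φ i = a i o`. Welfare optimality follows because the total
rider value lies below its tangent with slope `p` (`IsDemand.integral_riderValue_sub_le`); this uses
that the inverse demand is integrable at `0` (`IsDemand.integrableOn_riderValue`).

From an optimum, the inverse demand being unbounded at `0` forces positive rider flows
(`IsWelfareOptimal.rider_pos`), so that prices can be defined as marginal rider values. The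
first-order condition (`IsWelfareOptimal.pairing_le`) makes the profit `p - c` nonpositive on every
circulation of nonpositive duration. On the space of circulations it is therefore `ω d` for some
`ω ≥ 0`: every cycle has surplus rate exactly `ω`, and every cycle decomposition of `y` will do.
-/

namespace Ridesharing

/-! ### Circulations and their decomposition into directed cycles -/

variable {n : ℕ}

/-- The total weight of the flow `z` when a unit of flow on the trip `(i, j)` weighs `a i j`. -/
def pairing (a z : Fin n → Fin n → ℝ) : ℝ := ∑ i, ∑ j, a i j * z i j

theorem pairing_add (a z z' : Fin n → Fin n → ℝ) :
    pairing a (fun i j => z i j + z' i j) = pairing a z + pairing a z' := by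
  simp only [pairing, mul_add, Finset.sum_add_distrib]

theorem pairing_const_mul (a z : Fin n → Fin n → ℝ) (t : ℝ) :
    pairing a (fun i j => t * z i j) = t * pairing a z := by
  simp only [pairing, mul_left_comm _ t, ← Finset.mul_sum]

theorem sub_pairing (a b z : Fin n → Fin n → ℝ) :
    pairing (fun i j => a i j - b i j) z = pairing a z - pairing b z := by
  simp only [pairing, sub_mul, Finset.sum_sub_distrib]

theorem const_mul_pairing (a z : Fin n → Fin n → ℝ) (t : ℝ) :
    pairing (fun i j => t * a i j) z = t * pairing a z := by
  simp only [pairing, mul_assoc, ← Finset.mul_sum]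

/-- A flow on the complete directed graph (entries of any sign) is a circulation if at every
location the total outflow equals the total inflow. -/
def IsCirculation (z : Fin n → Fin n → ℝ) : Prop := ∀ i, ∑ j, z i j = ∑ j, z j i

theorem IsCirculation.add {z z' : Fin n → Fin n → ℝ} (h : IsCirculation z)
    (h' : IsCirculation z') : IsCirculation (fun i j => z i j + z' i j) := fun i => by
  simp only [Finset.sum_add_distrib, h i, h' i]

theorem IsCirculation.const_mul {z : Fin n → Fin n → ℝ} (h : IsCirculation z) (t : ℝ) :
    IsCirculation (fun i j => t * z i j) := fun i => by
  simp only [← Finset.mul_sum, h i]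

open scoped Classical in
/-- One unit of flow along the cycle `κ`. -/
def cycleFlow (κ : DirectedCycle n) (i j : Fin n) : ℝ := if (i, j) ∈ κ.1 then 1 else 0

theorem isCirculation_cycleFlow (κ : DirectedCycle n) : IsCirculation (cycleFlow κ) := by
  classical
  obtain ⟨κ, ℓ, v, hv, rfl⟩ := κ
  -- The flow is the sum over the steps of the cycle, since different steps start differently.
  have key : ∀ i j, cycleFlow ⟨_, ℓ, v, hv, rfl⟩ i j =
      ∑ k, if v k = i then (if v (k + 1) = j then (1 : ℝ) else 0) else 0 := by
    intro i j
    unfold cycleFlow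
    by_cases hi : ∃ k, v k = i
    · obtain ⟨k, rfl⟩ := hi
      simp [hv.eq_iff]
    · push Not at hi
      simp [hi]
  intro i
  simp only [key]
  conv_lhs => rw [Finset.sum_comm]
  conv_rhs => rw [Finset.sum_comm]
  have h1 : ∀ k, ∑ j, (if v k = i then (if v (k + 1) = j then (1 : ℝ) else 0) else 0) =
      if v k = i then 1 else 0 := fun k => by split_ifs <;> simp
  have h2 : ∀ k, ∑ j, (if v k = j then (if v (k + 1) = i then (1 : ℝ) else 0) else 0) =
      if v (k + 1) = i then 1 else 0 := fun k => by simp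
  simp only [h1, h2]
  exact (Equiv.sum_comp (Equiv.addRight (1 : Fin (ℓ + 1)))
    (fun k => if v k = i then (1 : ℝ) else 0)).symm

theorem pairing_cycleFlow (a : Fin n → Fin n → ℝ) (κ : DirectedCycle n) :
    pairing a (cycleFlow κ) = ∑ t ∈ κ.1, a t.1 t.2 := by
  classical
  rw [pairing, ← Fintype.sum_prod_type' (fun i j => a i j * cycleFlow κ i j)]
  simp [cycleFlow, Finset.sum_ite_mem]

theorem DirectedCycle.nonempty (κ : DirectedCycle n) : κ.1.Nonempty := by
  obtain ⟨κ, ℓ, v, hv, rfl⟩ := κ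
  simp

/-- A nonzero nonnegative circulation is positive on all trips of some directed cycle: from a
location with positive inflow one can always move on along a trip with positive flow, and such a
walk eventually becomes periodic. -/
theorem IsCirculation.exists_cycle_pos {y : Fin n → Fin n → ℝ} (h : IsCirculation y)
    (h0 : ∀ i j, 0 ≤ y i j) (hne : ∃ i j, y i j ≠ 0) :
    ∃ κ : DirectedCycle n, ∀ t ∈ κ.1, 0 < y t.1 t.2 := by
  classical
  obtain ⟨i₀, j₀, hij⟩ := hne
  have step : ∀ j, ∃ k, (∃ i, 0 < y i j) → 0 < y j k := by
    intro j
    by_cases hj : ∃ i, 0 < y i j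
    · obtain ⟨i, hi⟩ := hj
      by_contra! hcon
      have hz : ∑ k, y j k ≤ 0 := Finset.sum_nonpos fun k _ => (hcon k).2
      rw [h j] at hz
      exact absurd (Finset.single_le_sum (f := fun k => y k j) (fun k _ => h0 k j)
        (Finset.mem_univ i)) (not_le.2 (hz.trans_lt hi))
    · exact ⟨j, fun h => absurd h hj⟩
  choose s hs using step
  have hpos : ∀ k, ∃ i, 0 < y i (s^[k] j₀) := by
    intro k
    induction k with
    | zero => exact ⟨i₀, lt_of_le_of_ne (h0 _ _) (Ne.symm hij)⟩
    | succ k ih => exact ⟨s^[k] j₀, by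
        rw [Function.iterate_succ_apply']; exact hs _ ih⟩
  obtain ⟨a, b, hab, heq⟩ := Set.Finite.exists_lt_map_eq_of_forall_mem
    (f := fun k : ℕ => s^[k] j₀) (fun _ => Set.mem_univ _) Set.finite_univ
  set u := s^[a] j₀ with hu
  have hper : u ∈ Function.periodicPts s := by
    refine ⟨b - a, by omega, ?_⟩
    change s^[b - a] u = u
    rw [hu, ← Function.iterate_add_apply, Nat.sub_add_cancel hab.le]
    exact heq.symm
  obtain ⟨ℓ, hℓ⟩ : ∃ ℓ, Function.minimalPeriod s u = ℓ + 1 :=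
    Nat.exists_eq_succ_of_ne_zero (Function.minimalPeriod_pos_of_mem_periodicPts hper).ne'
  have hsucc : ∀ k : Fin (ℓ + 1), s^[((k + 1 : Fin (ℓ + 1)) : ℕ)] u = s (s^[(k : ℕ)] u) := by
    intro k
    rw [← Function.iterate_succ_apply' s, Fin.val_add_one]
    split_ifs with hk
    · rw [hk, Fin.val_last, Nat.succ_eq_add_one, ← hℓ, Function.iterate_minimalPeriod]
      rfl
    · rfl
  refine ⟨⟨_, ℓ, fun k => s^[(k : ℕ)] u, ?_, rfl⟩, ?_⟩
  · intro k k' hkk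
    exact Fin.ext (Function.iterate_injOn_Iio_minimalPeriod (f := s) (x := u)
      (by rw [hℓ]; exact k.2) (by rw [hℓ]; exact k'.2) hkk)
  · intro t ht
    obtain ⟨k, -, rfl⟩ := Finset.mem_image.1 ht
    simp only [hsucc]
    refine hs _ ?_
    rw [hu, ← Function.iterate_add_apply]
    exact hpos _

/-- Every nonnegative circulation is a nonnegative combination of directed cycles: subtract as much
flow as possible along a cycle of positive trips and induct on the number of positive trips. -/
theorem IsCirculation.exists_isCycleDecomposition {y : Fin n → Fin n → ℝ} (h : IsCirculation y)
    (h0 : ∀ i j, 0 ≤ y i j) : ∃ w, Economy.IsCycleDecomposition y w := by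
  classical
  induction hN : (Finset.univ.filter fun t : Fin n × Fin n => y t.1 t.2 ≠ 0).card
    using Nat.strong_induction_on generalizing y with
  | _ N ih =>
  by_cases hne : ∃ i j, y i j ≠ 0
  swap
  · push Not at hne
    exact ⟨0, by simp, by simp [hne]⟩
  obtain ⟨κ, hκ⟩ := h.exists_cycle_pos h0 hne
  obtain ⟨e, heκ, hmin⟩ := κ.1.exists_min_image (fun t => y t.1 t.2) κ.nonempty
  set ε := y e.1 e.2 with hε
  have hεpos : 0 < ε := hκ e heκ
  set y' : Fin n → Fin n → ℝ := fun i j => y i j + -ε * cycleFlow κ i j with hy'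
  have hcirc : IsCirculation y' := h.add ((isCirculation_cycleFlow κ).const_mul _)
  have hnn : ∀ i j, 0 ≤ y' i j := by
    intro i j
    simp only [hy', cycleFlow]
    split_ifs with hm
    · linarith [hmin _ hm]
    · simpa using h0 i j
  have hcard : (Finset.univ.filter fun t : Fin n × Fin n => y' t.1 t.2 ≠ 0).card < N := by
    rw [← hN]
    refine Finset.card_lt_card (Finset.ssubset_iff_of_subset ?_ |>.2 ⟨e, ?_, ?_⟩)
    · intro t ht
      simp only [Finset.mem_filter, Finset.mem_univ, true_and] at ht ⊢
      intro h0
      apply ht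
      have : t ∉ κ.1 := fun hm => by linarith [hκ t hm]
      simp [hy', cycleFlow, h0, this]
    · simpa using hεpos.ne'
    · simp [hy', cycleFlow, heκ, ← hε]
  obtain ⟨w, hw0, hw⟩ := ih _ hcard hcirc hnn rfl
  refine ⟨fun κ' => w κ' + if κ' = κ then ε else 0, fun κ' => ?_, fun i j => ?_⟩
  · exact add_nonneg (hw0 κ') (by split_ifs <;> linarith)
  · have hsplit : ∀ κ' : DirectedCycle n,
        (if (i, j) ∈ κ'.1 then (w κ' + if κ' = κ then ε else 0) else 0) =
        (if (i, j) ∈ κ'.1 then w κ' else 0) + if κ' = κ then ε * cycleFlow κ i j else 0 := by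
      intro κ'
      by_cases hk : κ' = κ
      · subst hk
        simp only [cycleFlow]
        split_ifs <;> simp
      · simp [hk]
    rw [Finset.sum_congr rfl fun κ' _ => hsplit κ', Finset.sum_add_distrib, hw i j]
    simp [hy']

theorem Economy.IsCycleDecomposition.pairing_eq {y : Fin n → Fin n → ℝ} {w : DirectedCycle n → ℝ}
    (h : Economy.IsCycleDecomposition y w) (a : Fin n → Fin n → ℝ) :
    pairing a y = ∑ κ, w κ * ∑ t ∈ κ.1, a t.1 t.2 := by
  classical
  have hy : ∀ i j, a i j * y i j = ∑ κ, w κ * (a i j * cycleFlow κ i j) := by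
    intro i j
    rw [← h.2 i j, Finset.mul_sum]
    refine Finset.sum_congr rfl fun κ _ => ?_
    unfold cycleFlow
    split_ifs <;> ring
  simp only [← pairing_cycleFlow, pairing, hy, Finset.mul_sum]
  rw [Finset.sum_comm' (t' := Finset.univ) (s' := fun _ => Finset.univ) (by simp)]
  conv_rhs => rw [Finset.sum_comm]
  rw [Finset.sum_comm]
  exact Finset.sum_congr rfl fun i _ => Finset.sum_comm

/-! ### Demand functions and the value of riders -/

open MeasureTheory Set Filter Topology

/-- The properties of a demand function on `[0, ∞)` that matter for the theorem. -/
structure IsDemand (q : ℝ → ℝ) : Prop where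
  nonneg : ∀ r, 0 ≤ r → 0 ≤ q r
  strictAntiOn : StrictAntiOn q (Ici 0)
  continuousOn : ContinuousOn q (Ici 0)
  integrableOn : IntegrableOn q (Ici 0)

theorem Economy.isDemand {n : ℕ} (E : Economy n) (i j : Fin n) : IsDemand (E.q i j) where
  nonneg := E.q_nonneg i j
  continuousOn := (E.q_contDiff i j).continuousOn
  integrableOn := E.q_integrable i j
  strictAntiOn := by
    refine strictAntiOn_of_deriv_neg (convex_Ici 0) (E.q_contDiff i j).continuousOn ?_
    intro r hr
    rw [interior_Ici] at hr
    rw [← derivWithin_of_mem_nhds (Ici_mem_nhds hr)]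
    exact E.q_deriv_neg i j r (le_of_lt hr)

namespace IsDemand

variable {q : ℝ → ℝ}

theorem pos (h : IsDemand q) {r : ℝ} (hr : 0 ≤ r) : 0 < q r :=
  (h.nonneg (r + 1) (by linarith)).trans_lt
    (h.strictAntiOn (mem_Ici.2 hr) (mem_Ici.2 (by linarith)) (by linarith))

theorem le_zero (h : IsDemand q) {r : ℝ} (hr : 0 ≤ r) : q r ≤ q 0 :=
  h.strictAntiOn.antitoneOn self_mem_Ici (mem_Ici.2 hr) hr

/-- Integrability forces the demand to fall below every positive level. -/
theorem surjOn (h : IsDemand q) : SurjOn q (Ici 0) (Ioc 0 (q 0)) := by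
  rintro s ⟨hs, hs0⟩
  obtain ⟨R, hR, hRs⟩ : ∃ R, 0 ≤ R ∧ q R < s := by
    by_contra! hcon
    have hint : IntegrableOn (fun _ : ℝ => s) (Ici (0 : ℝ)) := by
      refine Integrable.mono' h.integrableOn aestronglyMeasurable_const ?_
      filter_upwards [ae_restrict_mem measurableSet_Ici] with r hr
      rw [Real.norm_of_nonneg hs.le]
      exact hcon r hr
    rw [integrableOn_const_iff] at hint
    simp [hs.ne'] at hint
  obtain ⟨r, hr, rfl⟩ := intermediate_value_Icc' hR
    (h.continuousOn.mono Icc_subset_Ici_self) ⟨hRs.le, hs0⟩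
  exact ⟨r, hr.1, rfl⟩

theorem riderValue_nonneg (h : IsDemand q) {s : ℝ} (hs : s ∈ Ioc 0 (q 0)) : 0 ≤ riderValue q s :=
  Function.invFunOn_mem (h.surjOn hs)

theorem apply_riderValue (h : IsDemand q) {s : ℝ} (hs : s ∈ Ioc 0 (q 0)) :
    q (riderValue q s) = s :=
  Function.invFunOn_eq (h.surjOn hs)

theorem riderValue_apply (h : IsDemand q) {r : ℝ} (hr : 0 ≤ r) : riderValue q (q r) = r :=
  h.strictAntiOn.injOn.leftInvOn_invFunOn hr

theorem lt_riderValue_iff (h : IsDemand q) {r s : ℝ} (hr : 0 ≤ r) (hs : s ∈ Ioc 0 (q 0)) :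
    r < riderValue q s ↔ s < q r := by
  conv_rhs => rw [← h.apply_riderValue hs]
  exact (h.strictAntiOn.lt_iff_gt (h.riderValue_nonneg hs) hr).symm

theorem riderValue_lt_iff (h : IsDemand q) {r s : ℝ} (hr : 0 ≤ r) (hs : s ∈ Ioc 0 (q 0)) :
    riderValue q s < r ↔ q r < s := by
  conv_rhs => rw [← h.apply_riderValue hs]
  exact (h.strictAntiOn.lt_iff_gt hr (h.riderValue_nonneg hs)).symm

theorem antitoneOn_riderValue (h : IsDemand q) : AntitoneOn (riderValue q) (Ioc 0 (q 0)) := by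
  intro s hs t ht hst
  by_contra! hlt
  rw [h.lt_riderValue_iff (h.riderValue_nonneg hs) ht, h.apply_riderValue hs] at hlt
  exact absurd hlt (not_lt.2 hst)

/-- The layer cake formula turns the integral of the inverse `v` into the integral of `q`, since
`{s | r < v s} = (0, q r)`. -/
theorem integrableOn_riderValue (h : IsDemand q) : IntegrableOn (riderValue q) (Ioc 0 (q 0)) := by
  have hmeas : AEMeasurable (riderValue q) (volume.restrict (Ioc 0 (q 0))) :=
    aemeasurable_restrict_of_antitoneOn measurableSet_Ioc h.antitoneOn_riderValue
  have hnn : 0 ≤ᵐ[volume.restrict (Ioc 0 (q 0))] riderValue q := by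
    filter_upwards [ae_restrict_mem measurableSet_Ioc] with s hs
    exact h.riderValue_nonneg hs
  refine ⟨hmeas.aestronglyMeasurable, ?_⟩
  rw [hasFiniteIntegral_iff_ofReal hnn, lintegral_eq_lintegral_meas_lt _ hnn hmeas]
  have hfin : ∫⁻ r in Ioi (0 : ℝ), ENNReal.ofReal (q r) < ⊤ := by
    have hi : IntegrableOn q (Ioi 0) := h.integrableOn.mono_set Ioi_subset_Ici_self
    refine (hasFiniteIntegral_iff_ofReal ?_).1 hi.2
    filter_upwards [ae_restrict_mem measurableSet_Ioi] with r hr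
    exact h.nonneg r (le_of_lt hr)
  refine lt_of_le_of_lt (setLIntegral_mono' measurableSet_Ioi fun r hr => ?_) hfin
  rw [Measure.restrict_apply' measurableSet_Ioc]
  refine (measure_mono (t := Ioo 0 (q r)) ?_).trans (by simp)
  rintro s ⟨hrs, hs⟩
  exact ⟨hs.1, (h.lt_riderValue_iff (le_of_lt hr) hs).1 hrs⟩

theorem intervalIntegrable_riderValue (h : IsDemand q) {a b : ℝ}
    (ha : a ∈ Icc 0 (q 0)) (hb : b ∈ Icc 0 (q 0)) :
    IntervalIntegrable (riderValue q) volume a b := by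
  rw [intervalIntegrable_iff]
  refine h.integrableOn_riderValue.mono_set fun s hs => ?_
  rw [uIoc, mem_Ioc] at hs
  exact ⟨(le_min ha.1 hb.1).trans_lt hs.1, hs.2.trans (max_le ha.2 hb.2)⟩

/-- Concavity of the total rider value: it lies below its tangent at `a`. -/
theorem integral_riderValue_sub_le (h : IsDemand q) {a b : ℝ}
    (ha : a ∈ Ioc 0 (q 0)) (hb : b ∈ Icc 0 (q 0)) :
    (∫ s in (0 : ℝ)..b, riderValue q s) - ∫ s in (0 : ℝ)..a, riderValue q s ≤
      riderValue q a * (b - a) := by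
  have h0 : (0 : ℝ) ∈ Icc 0 (q 0) := ⟨le_rfl, (h.pos le_rfl).le⟩
  have ha' := Ioc_subset_Icc_self ha
  rw [intervalIntegral.integral_interval_sub_left (h.intervalIntegrable_riderValue h0 hb)
    (h.intervalIntegrable_riderValue h0 ha')]
  have hab := h.intervalIntegrable_riderValue ha' hb
  have hconst : riderValue q a * (b - a) = ∫ _ in a..b, riderValue q a := by
    rw [intervalIntegral.integral_const, smul_eq_mul, mul_comm]
  rw [hconst]
  rcases le_total a b with hle | hle
  · refine intervalIntegral.integral_mono_on_of_le_Ioo hle hab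
      intervalIntegrable_const fun s hs => ?_
    exact h.antitoneOn_riderValue ha ⟨ha.1.trans hs.1, hs.2.le.trans hb.2⟩ hs.1.le
  · rw [intervalIntegral.integral_symm, intervalIntegral.integral_symm b a, neg_le_neg_iff]
    refine intervalIntegral.integral_mono_on_of_le_Ioo hle intervalIntegrable_const
      hab.symm fun s hs => ?_
    exact h.antitoneOn_riderValue ⟨hb.1.trans_lt hs.1, hs.2.le.trans ha.2⟩ ha hs.2.le

/-- The inverse demand, extended by `0 = v (q 0)` to the right of `q 0`, is continuous on
`(0, ∞)`. -/
theorem continuousAt_riderValue_min (h : IsDemand q) {a : ℝ} (ha : 0 < a) :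
    ContinuousAt (fun s => riderValue q (min s (q 0))) a := by
  have hq0 := h.pos le_rfl
  have hmem : ∀ {s : ℝ}, 0 < s → min s (q 0) ∈ Ioc 0 (q 0) := fun hs =>
    ⟨lt_min hs hq0, min_le_right _ _⟩
  have hpos : ∀ᶠ s in 𝓝 a, 0 < s := lt_mem_nhds ha
  refine tendsto_order.2 ⟨fun r hr => ?_, fun r hr => ?_⟩
  · rcases lt_or_ge r 0 with hr0 | hr0
    · filter_upwards [hpos] with s hs
      exact hr0.trans_le (h.riderValue_nonneg (hmem hs))
    · rw [h.lt_riderValue_iff hr0 (hmem ha)] at hr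
      have hev : ∀ᶠ s in 𝓝 a, min s (q 0) < q r :=
        (continuous_id.min continuous_const).continuousAt.eventually_lt_const hr
      filter_upwards [hpos, hev] with s hs hs'
      exact (h.lt_riderValue_iff hr0 (hmem hs)).2 hs'
  · have hr0 : 0 ≤ r := (h.riderValue_nonneg (hmem ha)).trans hr.le
    replace hr := (h.riderValue_lt_iff hr0 (hmem ha)).1 hr
    have hev : ∀ᶠ s in 𝓝 a, q r < min s (q 0) :=
      (continuous_id.min continuous_const).continuousAt.eventually_const_lt hr
    filter_upwards [hpos, hev] with s hs hs'
    exact (h.riderValue_lt_iff hr0 (hmem hs)).2 hs'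

theorem riderValue_max (h : IsDemand q) : riderValue q (q 0) = 0 := h.riderValue_apply le_rfl

end IsDemand

namespace Economy

/-! ### Welfare as a real number -/

variable {n : ℕ} {E : Economy n} {x y p : Fin n → Fin n → ℝ}

theorem coe_sum_sum (f : Fin n → Fin n → ℝ) :
    ((∑ i, ∑ j, f i j : ℝ) : EReal) = ∑ i, ∑ j, (f i j : EReal) := by
  have h : ∀ g : Fin n → ℝ, ((∑ i, g i : ℝ) : EReal) = ∑ i, (g i : EReal) := fun g =>
    map_sum (⟨⟨Real.toEReal, EReal.coe_zero⟩, EReal.coe_add⟩ : ℝ →+ EReal) g _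
  simp only [h]

theorem welfare_eq_coe (hx : ∀ i j, x i j ∈ Icc 0 (E.q i j 0)) :
    E.welfare x y = ((∑ i, ∑ j,
      ((∫ s in (0 : ℝ)..x i j, riderValue (E.q i j) s) - E.c i j * y i j) : ℝ) : EReal) := by
  rw [coe_sum_sum]
  refine Finset.sum_congr rfl fun i _ => Finset.sum_congr rfl fun j _ => ?_
  rw [totalRiderValue, if_pos ⟨(hx i j).1, (hx i j).2⟩, EReal.coe_sub]

theorem welfare_eq_bot {i j : Fin n} (hx : x i j ∉ Icc 0 (E.q i j 0)) :
    E.welfare x y = ⊥ := by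
  have h : totalRiderValue (E.q i j) (x i j) = ⊥ := if_neg hx
  rw [welfare, ← Finset.add_sum_erase _ _ (Finset.mem_univ i),
    ← Finset.add_sum_erase _ _ (Finset.mem_univ j), h, sub_eq_add_neg, EReal.bot_add,
    EReal.bot_add, EReal.bot_add]

/-! ### Equilibrium prices -/

theorem sum_d_pos (E : Economy n) (κ : DirectedCycle n) : 0 < ∑ t ∈ κ.1, E.d t.1 t.2 :=
  Finset.sum_pos (fun _ _ => E.d_pos _ _) κ.nonempty

/-- The total weight of a cycle when the weight of a trip is its profit minus its share of a target
surplus rate `ω`. -/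
theorem sum_sub_const_mul_d (E : Economy n) (p : Fin n → Fin n → ℝ) (ω : ℝ)
    (κ : DirectedCycle n) :
    ∑ t ∈ κ.1, (p t.1 t.2 - E.c t.1 t.2 - ω * E.d t.1 t.2) =
      (E.surplusRate p κ - ω) * ∑ t ∈ κ.1, E.d t.1 t.2 := by
  rw [Finset.sum_sub_distrib, ← Finset.mul_sum, sub_mul, surplusRate,
    div_mul_cancel₀ _ (E.sum_d_pos κ).ne']

theorem surplusRate_le_max (E : Economy n) (p : Fin n → Fin n → ℝ) (κ : DirectedCycle n) :
    E.surplusRate p κ ≤ E.maxSurplusRate p :=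
  le_ciSup (Set.finite_range _).bddAbove κ

/-- One unit of flow on the trip `(i, j)`. -/
def tripFlow (i j k l : Fin n) : ℝ := if k = i then (if l = j then 1 else 0) else 0

theorem pairing_tripFlow (a : Fin n → Fin n → ℝ) (i j : Fin n) :
    pairing a (tripFlow i j) = a i j := by
  simp [pairing, tripFlow]

/-- The trips `(i, j)`, `(j, k)` and the reverse of `(i, k)` balance at every location. -/
theorem isCirculation_triangle (i j k : Fin n) :
    IsCirculation fun u v => tripFlow i j u v + (tripFlow j k u v + -1 * tripFlow i k u v) := by
  intro u
  have h1 : ∀ a b : Fin n, ∑ v, tripFlow a b u v = if u = a then 1 else 0 := fun a b => by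
    simp only [tripFlow]; split_ifs <;> simp
  have h2 : ∀ a b : Fin n, ∑ v, tripFlow a b v u = if u = b then 1 else 0 := fun a b => by
    simp [tripFlow]
  simp only [Finset.sum_add_distrib, ← Finset.mul_sum, h1, h2]
  ring

theorem IsCompetitiveEquilibrium.rider_mem (h : E.IsCompetitiveEquilibrium x y p) (i j : Fin n) :
    x i j ∈ Ioc 0 (E.q i j 0) := by
  rw [h.rider_best_response i j]
  exact ⟨(E.isDemand i j).pos (h.price_nonneg i j), (E.isDemand i j).le_zero (h.price_nonneg i j)⟩

theorem IsCompetitiveEquilibrium.driver_pos (h : E.IsCompetitiveEquilibrium x y p)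
    (i j : Fin n) : 0 < y i j :=
  (h.rider_mem i j).1.trans_le (h.feasible.le i j)

theorem IsCompetitiveEquilibrium.maxSurplusRate_nonneg (h : E.IsCompetitiveEquilibrium x y p)
    (hn : 0 < n) : 0 ≤ E.maxSurplusRate p := by
  by_contra! hlt
  exact (h.driver_pos ⟨0, hn⟩ ⟨0, hn⟩).ne' (h.do_nothing hlt _ _)

/-- In equilibrium, the trip profits in excess of the maximal surplus rate cancel along every
circulation `z`. They are nonpositive along cycles, hence along nonnegative circulations, and cancel
along `y`; since `y` is positive everywhere, `y + t z` is a nonnegative circulation for small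
`t > 0`. -/
theorem IsCompetitiveEquilibrium.pairing_eq_zero (h : E.IsCompetitiveEquilibrium x y p)
    {z : Fin n → Fin n → ℝ} (hz : IsCirculation z) :
    pairing (fun i j => p i j - E.c i j - E.maxSurplusRate p * E.d i j) z = 0 := by
  set a := fun i j => p i j - E.c i j - E.maxSurplusRate p * E.d i j with ha
  have hκ : ∀ κ : DirectedCycle n, ∑ t ∈ κ.1, a t.1 t.2 =
      (E.surplusRate p κ - E.maxSurplusRate p) * ∑ t ∈ κ.1, E.d t.1 t.2 :=
    E.sum_sub_const_mul_d p _
  have hy : pairing a y = 0 := by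
    obtain ⟨w, hw, hmax⟩ := h.cycle_max
    rw [hw.pairing_eq]
    refine Finset.sum_eq_zero fun κ _ => ?_
    rcases (hw.1 κ).eq_or_lt with h0 | h0
    · rw [← h0, zero_mul]
    · rw [hκ, hmax κ h0, sub_self, zero_mul, mul_zero]
  have hnonneg : ∀ z, IsCirculation z → (∀ i j, 0 ≤ z i j) → pairing a z ≤ 0 := by
    intro z hz h0
    obtain ⟨w, hw⟩ := hz.exists_isCycleDecomposition h0
    rw [hw.pairing_eq]
    refine Finset.sum_nonpos fun κ _ => mul_nonpos_of_nonneg_of_nonpos (hw.1 κ) ?_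
    rw [hκ]
    exact mul_nonpos_of_nonpos_of_nonneg (sub_nonpos.2 (E.surplusRate_le_max p κ))
      (E.sum_d_pos κ).le
  have hle : ∀ z, IsCirculation z → pairing a z ≤ 0 := by
    intro z hz
    have hev : ∀ᶠ t in 𝓝[>] (0 : ℝ), ∀ i j, 0 < y i j + t * z i j := by
      refine eventually_all.2 fun i => eventually_all.2 fun j => nhdsWithin_le_nhds ?_
      have hc : ContinuousAt (fun t : ℝ => y i j + t * z i j) 0 := by fun_prop
      exact hc.eventually_const_lt (by simpa using h.driver_pos i j)
    obtain ⟨t, ht, ht0⟩ := (hev.and self_mem_nhdsWithin).exists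
    have := hnonneg _ (IsCirculation.add h.feasible.balance (hz.const_mul t))
      fun i j => (ht i j).le
    rw [pairing_add, pairing_const_mul, hy, zero_add] at this
    exact nonpos_of_mul_nonpos_right this ht0
  have h1 := hle z hz
  have h2 := hle _ (hz.const_mul (-1))
  rw [pairing_const_mul] at h2
  linarith

/-- The potential of a location is the excess profit of the trip to a fixed base location. -/
theorem IsCompetitiveEquilibrium.exists_potential (h : E.IsCompetitiveEquilibrium x y p)
    (hn : 0 < n) : ∃ φ : Fin n → ℝ,
      ∀ i j, p i j = E.c i j + E.d i j * E.maxSurplusRate p + φ i - φ j := by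
  refine ⟨fun i => p i ⟨0, hn⟩ - E.c i ⟨0, hn⟩ - E.maxSurplusRate p * E.d i ⟨0, hn⟩,
    fun i j => ?_⟩
  have := h.pairing_eq_zero (isCirculation_triangle i j ⟨0, hn⟩)
  rw [pairing_add, pairing_add, pairing_const_mul, pairing_tripFlow, pairing_tripFlow,
    pairing_tripFlow] at this
  linarith

/-- Riders gain at most `p (x' - x) ≤ p (y' - y)` from a change of the flows, and the part of
`(p - c) (y' - y)` that does not cancel along the circulation `y' - y` is the value `ω` of
additional driver supply, of which there is none if `ω > 0`. -/
theorem IsCompetitiveEquilibrium.isWelfareOptimal (h : E.IsCompetitiveEquilibrium x y p)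
    (hn : 0 < n) : E.IsWelfareOptimal x y := by
  refine ⟨h.feasible.toSatisfiesConstraints, fun x' y' h' => ?_⟩
  by_cases hx' : ∀ i j, x' i j ∈ Icc 0 (E.q i j 0)
  swap
  · push Not at hx'
    obtain ⟨i, j, hij⟩ := hx'
    rw [welfare_eq_bot hij]
    exact bot_le
  rw [welfare_eq_coe hx', welfare_eq_coe fun i j => Ioc_subset_Icc_self (h.rider_mem i j),
    EReal.coe_le_coe_iff, ← sub_nonpos]
  set ω := E.maxSurplusRate p with hω
  have hdiff : IsCirculation fun i j => y' i j + -1 * y i j :=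
    IsCirculation.add h'.balance (IsCirculation.const_mul h.feasible.balance (-1))
  have hsupply : ω * pairing E.d (fun i j => y' i j + -1 * y i j) ≤ 0 := by
    rw [pairing_add, pairing_const_mul]
    rcases (h.maxSurplusRate_nonneg hn).eq_or_lt with h0 | h0
    · rw [hω, ← h0, zero_mul]
    · refine mul_nonpos_of_nonneg_of_nonpos h0.le ?_
      have h1 : pairing E.d y = E.m := h.exhaust_supply h0
      have h2 : pairing E.d y' ≤ E.m := h'.supply
      linarith
  have hzero := h.pairing_eq_zero hdiff
  rw [sub_pairing, const_mul_pairing] at hzero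
  have hterm : ∑ i, ∑ j, ((∫ s in (0 : ℝ)..x' i j, riderValue (E.q i j) s) - E.c i j * y' i j) -
      ∑ i, ∑ j, ((∫ s in (0 : ℝ)..x i j, riderValue (E.q i j) s) - E.c i j * y i j) ≤
      pairing (fun i j => p i j - E.c i j) (fun i j => y' i j + -1 * y i j) := by
    rw [pairing, ← Finset.sum_sub_distrib]
    refine Finset.sum_le_sum fun i _ => ?_
    rw [← Finset.sum_sub_distrib]
    refine Finset.sum_le_sum fun j _ => ?_
    have h1 := (E.isDemand i j).integral_riderValue_sub_le (h.rider_mem i j) (hx' i j)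
    have hv : riderValue (E.q i j) (x i j) = p i j := by
      rw [h.rider_best_response i j, (E.isDemand i j).riderValue_apply (h.price_nonneg i j)]
    have h2 : p i j * x i j = p i j * y i j := by
      rcases (h.feasible.le i j).eq_or_lt with he | hl
      · rw [he]
      · rw [h.relocation i j hl, zero_mul, zero_mul]
    have h3 := mul_le_mul_of_nonneg_left (h'.le i j) (h.price_nonneg i j)
    rw [hv] at h1
    linarith
  linarith

/-! ### Prices supporting an optimal flow -/

theorem IsWelfareOptimal.rider_mem_Icc (h : E.IsWelfareOptimal x y) (i j : Fin n) :
    x i j ∈ Icc 0 (E.q i j 0) := by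
  by_contra hx
  have h0 : E.SatisfiesConstraints 0 0 :=
    ⟨fun _ _ => le_rfl, by simpa using E.m_pos.le, fun _ => by simp⟩
  have := h.2 0 0 h0
  rw [welfare_eq_bot hx, welfare_eq_coe (x := 0) fun i j =>
    ⟨le_rfl, ((E.isDemand i j).pos le_rfl).le⟩,
    le_bot_iff] at this
  exact EReal.coe_ne_bot _ this

/-- The first-order condition of optimality, with the marginal rider values taken at the flow that
the optimum is compared with. -/
theorem IsWelfareOptimal.sum_riderValue_mul_le (h : E.IsWelfareOptimal x y)
    {x' y' : Fin n → Fin n → ℝ} (h' : E.SatisfiesConstraints x' y')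
    (hx' : ∀ i j, x' i j ∈ Ioc 0 (E.q i j 0)) :
    ∑ i, ∑ j, riderValue (E.q i j) (x' i j) * (x' i j - x i j) ≤
      ∑ i, ∑ j, E.c i j * (y' i j - y i j) := by
  have hle := h.2 x' y' h'
  rw [welfare_eq_coe h.rider_mem_Icc, welfare_eq_coe fun i j => Ioc_subset_Icc_self (hx' i j),
    EReal.coe_le_coe_iff] at hle
  have hterm : ∑ i, ∑ j, riderValue (E.q i j) (x' i j) * (x' i j - x i j) ≤
      ∑ i, ∑ j, ((∫ s in (0 : ℝ)..x' i j, riderValue (E.q i j) s) -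
        ∫ s in (0 : ℝ)..x i j, riderValue (E.q i j) s) := by
    refine Finset.sum_le_sum fun i _ => Finset.sum_le_sum fun j _ => ?_
    have := (E.isDemand i j).integral_riderValue_sub_le (hx' i j) (h.rider_mem_Icc i j)
    linarith
  simp only [mul_sub, Finset.sum_sub_distrib] at hle hterm ⊢
  linarith

/-- An optimal flow serves some riders of every trip, because the value of the first riders is
unbounded: compare with flows `(1 - s) x + s δ`, where `δ` is a small constant flow. -/
theorem IsWelfareOptimal.rider_pos (h : E.IsWelfareOptimal x y) (i j : Fin n) : 0 < x i j := by
  by_contra! hxle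
  have hx0 : x i j = 0 := le_antisymm hxle (h.rider_mem_Icc i j).1
  obtain ⟨δ, hδ, hδq, hδm⟩ : ∃ δ : ℝ, 0 < δ ∧ (∀ k l, δ < E.q k l 0) ∧
      ∑ k, ∑ l, E.d k l * δ < E.m := by
    have h1 : ∀ᶠ δ in 𝓝[>] (0 : ℝ), ∀ k l, δ < E.q k l 0 :=
      eventually_all.2 fun k => eventually_all.2 fun l => nhdsWithin_le_nhds
        (gt_mem_nhds ((E.isDemand k l).pos le_rfl))
    have h2 : ∀ᶠ δ in 𝓝[>] (0 : ℝ), ∑ k, ∑ l, E.d k l * δ < E.m := by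
      have hc : ContinuousAt (fun δ : ℝ => ∑ k, ∑ l, E.d k l * δ) 0 := by fun_prop
      exact nhdsWithin_le_nhds (hc.eventually_lt_const (by simpa using E.m_pos))
    obtain ⟨δ, h3, h4⟩ := ((h1.and h2).and self_mem_nhdsWithin).exists
    exact ⟨δ, h4, h3⟩
  set C := ∑ k, ∑ l, (E.c k l * (δ - y k l) + riderValue (E.q k l) δ * x k l) with hC
  have hbound : ∀ s, 0 < s → s < 1 → riderValue (E.q i j) (s * δ) * δ ≤ C := by
    intro s hs hs1
    have hmem : ∀ k l, (1 - s) * x k l + s * δ ∈ Ioc 0 (E.q k l 0) := by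
      intro k l
      have h1 := mul_nonneg (sub_nonneg.2 hs1.le) (h.rider_mem_Icc k l).1
      have h2 := mul_pos hs hδ
      have h3 := mul_le_mul_of_nonneg_left (h.rider_mem_Icc k l).2 (sub_nonneg.2 hs1.le)
      have h4 := mul_le_mul_of_nonneg_left (hδq k l).le hs.le
      exact ⟨by linarith, by linarith⟩
    have hcon : E.SatisfiesConstraints (fun k l => (1 - s) * x k l + s * δ)
        (fun k l => (1 - s) * y k l + s * δ) := by
      refine ⟨fun k l => ?_, ?_, ?_⟩
      · have := mul_le_mul_of_nonneg_left (h.1.le k l) (sub_nonneg.2 hs1.le)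
        linarith
      · change pairing E.d (fun k l => (1 - s) * y k l + s * δ) ≤ E.m
        rw [pairing_add E.d (fun k l => (1 - s) * y k l) (fun _ _ => s * δ), pairing_const_mul,
          pairing_const_mul E.d (fun _ _ => δ)]
        have h1 : pairing E.d y ≤ E.m := h.1.supply
        have h2 : pairing E.d (fun _ _ => δ) ≤ E.m := hδm.le
        have h3 := mul_le_mul_of_nonneg_left h1 (sub_nonneg.2 hs1.le)
        have h4 := mul_le_mul_of_nonneg_left h2 hs.le
        linarith
      · exact (IsCirculation.const_mul h.1.balance (1 - s)).add fun _ => rfl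
    have hK := h.sum_riderValue_mul_le hcon hmem
    have hterm : ∀ k l, s * ((if k = i then (if l = j then
        riderValue (E.q i j) (s * δ) * δ else 0) else 0) - riderValue (E.q k l) δ * x k l) ≤
        riderValue (E.q k l) ((1 - s) * x k l + s * δ) *
          ((1 - s) * x k l + s * δ - x k l) := by
      intro k l
      have hδmem : δ ∈ Ioc 0 (E.q k l 0) := ⟨hδ, (hδq k l).le⟩
      have hx := (h.rider_mem_Icc k l).1
      have hv := (E.isDemand k l).riderValue_nonneg (hmem k l)
      have hvδ := mul_nonneg ((E.isDemand k l).riderValue_nonneg hδmem) hx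
      rw [show (1 - s) * x k l + s * δ - x k l = s * (δ - x k l) by ring, mul_left_comm]
      refine mul_le_mul_of_nonneg_left ?_ hs.le
      by_cases hkl : k = i ∧ l = j
      · obtain ⟨rfl, rfl⟩ := hkl
        simp [hx0]
      · have hif : (if k = i then (if l = j then
            riderValue (E.q i j) (s * δ) * δ else 0) else 0) = 0 := by
          split_ifs with h1 h2
          exacts [absurd ⟨h1, h2⟩ hkl, rfl, rfl]
        rw [hif, zero_sub]
        rcases le_total (x k l) δ with hle | hle
        · exact (neg_nonpos.2 hvδ).trans (mul_nonneg hv (sub_nonneg.2 hle))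
        · have hanti := (E.isDemand k l).antitoneOn_riderValue hδmem (hmem k l)
            (by nlinarith : δ ≤ (1 - s) * x k l + s * δ)
          have h1 := mul_le_mul_of_nonneg_right hanti hx
          have h2 := mul_nonneg hv hδ.le
          linarith
    have hsum := (Finset.sum_le_sum fun k _ => Finset.sum_le_sum fun l _ => hterm k l).trans hK
    have hy : ∀ k l, E.c k l * ((1 - s) * y k l + s * δ - y k l) =
        s * (E.c k l * (δ - y k l)) := fun k l => by ring
    simp only [hy, ← Finset.mul_sum] at hsum
    have := le_of_mul_le_mul_left hsum hs
    simp only [Finset.sum_sub_distrib, Finset.sum_ite_eq', Finset.mem_univ, if_true,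
      Finset.sum_ite_irrel, Finset.sum_const_zero] at this
    rw [hC]
    simp only [Finset.sum_add_distrib]
    linarith
  -- A price `r` with `r δ ≥ C`, and a scale `s` at which the marginal rider value exceeds `r`.
  set r := max 0 (C / δ) with hr
  have hr0 : 0 ≤ r := le_max_left _ _
  have hqr := (E.isDemand i j).pos hr0
  set s := min (1 / 2) (E.q i j r / (2 * δ)) with hs
  have hs0 : 0 < s := lt_min (by norm_num) (by positivity)
  have hs1 : s < 1 := (min_le_left _ _).trans_lt (by norm_num)
  have hsq : s * δ < E.q i j r := by
    have h1 : s * δ ≤ E.q i j r / (2 * δ) * δ := mul_le_mul_of_nonneg_right (min_le_right _ _) hδ.le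
    have h2 : E.q i j r / (2 * δ) * δ = E.q i j r / 2 := by field_simp
    linarith
  have hsmem : s * δ ∈ Ioc 0 (E.q i j 0) :=
    ⟨mul_pos hs0 hδ, hsq.le.trans ((E.isDemand i j).le_zero hr0)⟩
  have hlt := ((E.isDemand i j).lt_riderValue_iff hr0 hsmem).2 hsq
  have h1 := hbound s hs0 hs1
  have h2 := mul_lt_mul_of_pos_right hlt hδ
  have h3 : C ≤ r * δ := (div_le_iff₀ hδ).1 (le_max_right _ _)
  linarith

theorem IsWelfareOptimal.rider_mem (h : E.IsWelfareOptimal x y) (i j : Fin n) :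
    x i j ∈ Ioc 0 (E.q i j 0) := ⟨h.rider_pos i j, (h.rider_mem_Icc i j).2⟩

/-- No feasible direction `(ξ, η)` increases welfare to first order. The rider flow is cut off at
the maximal demand `q 0`; this loses nothing since the marginal rider value is `0` there. -/
theorem IsWelfareOptimal.pairing_le (h : E.IsWelfareOptimal x y) {ξ η : Fin n → Fin n → ℝ}
    (hev : ∀ᶠ t in 𝓝[>] (0 : ℝ), E.SatisfiesConstraints
      (fun i j => x i j + t * ξ i j) (fun i j => y i j + t * η i j)) :
    pairing (fun i j => riderValue (E.q i j) (x i j)) ξ ≤ pairing E.c η := by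
  set u : Fin n → Fin n → ℝ → ℝ := fun i j s => riderValue (E.q i j) (min s (E.q i j 0)) with hu
  have hlim : Tendsto (fun t : ℝ => ∑ i, ∑ j, u i j (x i j + t * ξ i j) * ξ i j) (𝓝[>] 0)
      (𝓝 (∑ i, ∑ j, u i j (x i j) * ξ i j)) := by
    refine tendsto_finsetSum _ fun i _ => tendsto_finsetSum _ fun j _ => ?_
    refine Tendsto.mul_const _ ?_
    have hc : Tendsto (fun t : ℝ => x i j + t * ξ i j) (𝓝[>] 0) (𝓝 (x i j)) := by
      have hc0 : ContinuousAt (fun t : ℝ => x i j + t * ξ i j) 0 := by fun_prop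
      simpa [ContinuousAt] using hc0.tendsto.mono_left nhdsWithin_le_nhds
    exact ((E.isDemand i j).continuousAt_riderValue_min (h.rider_pos i j)).tendsto.comp hc
  have hux : ∀ i j, u i j (x i j) = riderValue (E.q i j) (x i j) := fun i j => by
    simp only [hu, min_eq_left (h.rider_mem_Icc i j).2]
  simp only [hux] at hlim
  refine le_of_tendsto hlim ?_
  have hpos : ∀ᶠ t in 𝓝[>] (0 : ℝ), ∀ i j, 0 < x i j + t * ξ i j := by
    refine eventually_all.2 fun i => eventually_all.2 fun j => nhdsWithin_le_nhds ?_
    have hc : ContinuousAt (fun t : ℝ => x i j + t * ξ i j) 0 := by fun_prop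
    exact hc.eventually_const_lt (by simpa using h.rider_pos i j)
  filter_upwards [hev, hpos, self_mem_nhdsWithin] with t ht htpos ht0
  have hK := h.sum_riderValue_mul_le
    (x' := fun i j => min (x i j + t * ξ i j) (E.q i j 0))
    ⟨fun i j => (min_le_left _ _).trans (ht.le i j), ht.supply, ht.balance⟩
    fun i j => ⟨lt_min (htpos i j) ((E.isDemand i j).pos le_rfl), min_le_right _ _⟩
  have h1 : ∀ i j, riderValue (E.q i j) (min (x i j + t * ξ i j) (E.q i j 0)) *
      (min (x i j + t * ξ i j) (E.q i j 0) - x i j) =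
      t * (u i j (x i j + t * ξ i j) * ξ i j) := by
    intro i j
    simp only [hu]
    rcases le_total (x i j + t * ξ i j) (E.q i j 0) with hle | hle
    · rw [min_eq_left hle]; ring
    · rw [min_eq_right hle, (E.isDemand i j).riderValue_max]; ring
  have h2 : ∀ i j, E.c i j * (y i j + t * η i j - y i j) = t * (E.c i j * η i j) :=
    fun i j => by ring
  simp only [h1, h2, ← Finset.mul_sum] at hK
  exact le_of_mul_le_mul_left hK ht0

/-- The marginal rider values are equilibrium prices. On circulations, the total profit `p - c` is
nonpositive wherever the total duration is, so it is a nonnegative multiple `ω` of the duration;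
hence all cycles have the same surplus rate `ω`. -/
theorem IsWelfareOptimal.isCompetitiveEquilibrium (h : E.IsWelfareOptimal x y)
    (hf : E.IsFeasibleFlow x y) (hn : 0 < n) :
    E.IsCompetitiveEquilibrium x y fun i j => riderValue (E.q i j) (x i j) := by
  set p : Fin n → Fin n → ℝ := fun i j => riderValue (E.q i j) (x i j) with hp
  have hp0 : ∀ i j, 0 ≤ p i j := fun i j => (E.isDemand i j).riderValue_nonneg (h.rider_mem i j)
  set b : Fin n → Fin n → ℝ := fun i j => p i j - E.c i j with hb
  have hy : IsCirculation y := hf.balance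
  have hypos : ∀ i j, 0 < y i j := fun i j => (h.rider_pos i j).trans_le (hf.le i j)
  have hdir : ∀ η, IsCirculation η →
      (∀ᶠ t in 𝓝[>] (0 : ℝ), pairing E.d y + t * pairing E.d η ≤ E.m) → pairing b η ≤ 0 := by
    intro η hη hev
    rw [hb, sub_pairing, sub_nonpos]
    refine h.pairing_le (hev.mono fun t ht => ⟨fun i j => ?_, ?_, hy.add (hη.const_mul t)⟩)
    · have := hf.le i j
      linarith
    · change pairing E.d (fun i j => y i j + t * η i j) ≤ E.m
      rwa [pairing_add, pairing_const_mul]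
  have hnonpos : ∀ η, IsCirculation η → pairing E.d η ≤ 0 → pairing b η ≤ 0 := by
    intro η hη hd
    refine hdir η hη ?_
    filter_upwards [self_mem_nhdsWithin] with t ht
    have h1 : pairing E.d y ≤ E.m := hf.supply
    have h2 := mul_nonpos_of_nonneg_of_nonpos (le_of_lt (mem_Ioi.1 ht)) hd
    linarith
  have hdy : 0 < pairing E.d y := by
    have : Nonempty (Fin n) := ⟨⟨0, hn⟩⟩
    exact Finset.sum_pos (fun i _ => Finset.sum_pos (fun j _ => mul_pos (E.d_pos i j) (hypos i j))
      Finset.univ_nonempty) Finset.univ_nonempty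
  set ω := pairing b y / pairing E.d y with hω
  have hby : pairing b y = ω * pairing E.d y := (div_mul_cancel₀ _ hdy.ne').symm
  have hle : ∀ η, IsCirculation η → pairing b η ≤ ω * pairing E.d η := by
    intro η hη
    have h1 := hnonpos (fun i j => η i j + -(pairing E.d η / pairing E.d y) * y i j)
      (hη.add (hy.const_mul _)) (by
        rw [pairing_add, pairing_const_mul, neg_mul, div_mul_cancel₀ _ hdy.ne', add_neg_cancel])
    rw [pairing_add, pairing_const_mul, hby] at h1
    have h2 : pairing E.d η / pairing E.d y * (ω * pairing E.d y) = ω * pairing E.d η := by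
      field_simp
    linarith
  have hproportional : ∀ η, IsCirculation η → pairing b η = ω * pairing E.d η := by
    intro η hη
    refine le_antisymm (hle η hη) ?_
    have := hle _ (hη.const_mul (-1))
    rw [pairing_const_mul, pairing_const_mul] at this
    linarith
  have hω0 : 0 ≤ ω := by
    have h1 := hnonpos _ (hy.const_mul (-1)) (by rw [pairing_const_mul]; linarith)
    rw [pairing_const_mul] at h1
    exact div_nonneg (by linarith) hdy.le
  have hrate : ∀ κ, E.surplusRate p κ = ω := by
    intro κ
    have := hproportional _ (isCirculation_cycleFlow κ)
    rw [pairing_cycleFlow, pairing_cycleFlow] at this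
    exact (div_eq_iff (E.sum_d_pos κ).ne').2 this
  have hmax : E.maxSurplusRate p = ω := by
    obtain ⟨κ, hκ⟩ := (E.isGreatest_maxSurplusRate hn p).1
    rw [← hκ, hrate]
  refine ⟨hf, hp0, fun i j => ((E.isDemand i j).apply_riderValue (h.rider_mem i j)).symm,
    fun i j hlt => le_antisymm ?_ (hp0 i j), fun hpos => ?_, fun hneg => ?_, ?_⟩
  · -- A little more rider flow on the trip alone is feasible.
    have hle := h.pairing_le (ξ := tripFlow i j) (η := 0) ?_
    · rw [pairing_tripFlow] at hle
      simpa [pairing] using hle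
    · have hev : ∀ᶠ t in 𝓝[>] (0 : ℝ), x i j + t < y i j := by
        have hc : ContinuousAt (fun t : ℝ => x i j + t) 0 := by fun_prop
        exact nhdsWithin_le_nhds (hc.eventually_lt_const (by simpa using hlt))
      filter_upwards [hev] with t ht
      refine ⟨fun k l => ?_, by simpa using hf.supply, by simpa using hf.balance⟩
      by_cases hkl : k = i ∧ l = j
      · obtain ⟨rfl, rfl⟩ := hkl
        simpa [tripFlow] using ht.le
      · have h0 : tripFlow i j k l = 0 := by
          unfold tripFlow
          split_ifs with h1 h2
          exacts [absurd ⟨h1, h2⟩ hkl, rfl, rfl]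
        simpa [h0] using hf.le k l
  · -- With slack supply, the flow `y` itself could be scaled up at a profit.
    rw [hmax] at hpos
    refine le_antisymm hf.supply ?_
    by_contra! hlt
    have hev : ∀ᶠ t in 𝓝[>] (0 : ℝ), pairing E.d y + t * pairing E.d y ≤ E.m := by
      have hc : ContinuousAt (fun t : ℝ => pairing E.d y + t * pairing E.d y) 0 := by fun_prop
      refine nhdsWithin_le_nhds ((hc.eventually_lt_const ?_).mono fun _ => le_of_lt)
      change pairing E.d y + 0 * pairing E.d y < E.m
      rw [zero_mul, add_zero]
      exact hlt
    have h1 := hdir y hy hev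
    have h2 := mul_pos hpos hdy
    linarith
  · rw [hmax] at hneg
    exact absurd hneg (not_lt.2 hω0)
  · obtain ⟨w, hw⟩ := hy.exists_isCycleDecomposition hf.driver_nonneg
    exact ⟨w, hw, fun κ _ => by rw [hrate, hmax]⟩

end Economy

end Ridesharing

theorem mainTheorem3 (n : ℕ) (hn : 1 < n) (E : Ridesharing.Economy n) :
    (∀ x y : Fin n → Fin n → ℝ, E.IsFeasibleFlow x y →
      (E.IsWelfareOptimal x y ↔
        ∃ p : Fin n → Fin n → ℝ, E.IsCompetitiveEquilibrium x y p)) ∧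
    (∀ x y p : Fin n → Fin n → ℝ, E.IsCompetitiveEquilibrium x y p →
      ∃ (ω : ℝ) (φ : Fin n → ℝ), 0 ≤ ω ∧
        ∀ i j, p i j = E.c i j + E.d i j * ω + φ i - φ j) := by
  have hn0 : 0 < n := by omega
  refine ⟨fun x y hf => ⟨fun h => ⟨_, h.isCompetitiveEquilibrium hf hn0⟩, ?_⟩, fun x y p h => ?_⟩
  · rintro ⟨p, h⟩
    exact h.isWelfareOptimal hn0
  · obtain ⟨φ, hφ⟩ := h.exists_potential hn0
    exact ⟨E.maxSurplusRate p, φ, h.maxSurplusRate_nonneg hn0, hφ⟩
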